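/- **Setting.** All languages are over the alphabet of the $256$ byte values. Fix $k\le 126$, the largest number of subsequent length octets allowed in a DER length field ($k=126$ is full DER; $k=4$ is the restriction of encoded lengths to $[0,2^{32}-1]$). A *certificate schema* is written with the EBNF operators (concatenation, alternative, option, repetition, named fields) and DER identifier–length–contents nodes with shortest-form lengths. It is the X.509 `Certificate` type of RFC 5280, encoded in DER (with `SET OF` read as plain repetition), with the following restrictions. * Each `AlgorithmIdentifier` names one of the algorithms standardized in RFC 3279, 4055, 4491, 5480, 5758, and its parameters have the syntax fixed for that OID. * The `BIT STRING`s `signatureValue` and `subjectPublicKey` are parsed as constructed or as primitive values as prescribed for the OID of the accompanying algorithm. * `extnValue` is parsed according to `extnID` for the $17$ extensions standardized in RFC 5280; for every other OID it is an octet string without further structure. * The issuer name is non-empty. Any remaining `ANY` value (for instance that of a naming attribute whose type is not standardized) is a single DER element without further structure. A *parse* of a string $w$ is a tree recording every chosen alternative, every repetition, the division of $w$ among the parts of the schema, and the division of each element into identifier, length and contents octets. Let $R$ be an arbitrary language (any further constraints on certificates). Define: * $L_{\rm REG}$: the strings of $R$ that have a parse in which no two extensions have the same `extnID`, and a parse in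 which unique identifiers occur only in versions 2 and 3 and extensions only in version 3; * $L_{\rm AId\text{-}match}$: the strings that have a parse in which the encodings of `signature` and `signatureAlgorithm` are equal; * $L_{\rm SI\text{-}match}$: the strings that have a parse in which, if the encodings of `subject` and `issuer` are equal, the `keyIdentifier` of the authority key identifier extension is present; * $L_{\rm X.509\text{-}r2}=L_{\rm AId\text{-}match}\cap L_{\rm SI\text{-}match}\cap L_{\rm REG}$. **Lemma.** For all such $k$ and $R$: 1. $L_{\rm X.509\text{-}r2}$ is not inherently ambiguous: some context-free grammar generates it in which no sentence has two different leftmost derivations. 2. Every $w\in L_{\rm X.509\text{-}r2}$ has exactly one parse, and this parse satisfies all the conditions above (distinct extensions, version rules, matching algorithm identifiers, self-issued rule). 3. $L_{\rm REG}$ is the language accepted by a deterministic finite automaton, which has exactly one accepting path on each string of $L_{\rm REG}$; and every string of $L_{\rm REG}$ has exactly one parse. 4. The later stages only discard strings: $w\in L_{\rm X.509\text{-}r2}$ if and only if $w\in L_{\rm REG}$ and every parse of $w$ has matching algorithm identifiers and satisfies the self-issued rule. -/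

import Mathlib

/-!
The restricted X.509 certificate language over bytes: a schema calculus for DER (EBNF operators plus
tag-length-value nodes) with parse trees, the certificate schema of RFC 5280 in which every field
whose syntax depends on an object identifier is selected by that identifier, and the language
obtained by filtering the certificates that parse.
-/

namespace X509

/-- The terminal alphabet: the 256 byte values. -/
abbrev Byte := Fin 256

/-! ### Formal-language notions -/

section Languages

variable {T : Type*} {σ : Type*}

/-- `LeftmostDerivation g rs u v`: the string `u` is transformed into `v` by applying, in order, the
rules `rs` of `g`, each of them to the leftmost nonterminal of the current string. -/
inductive LeftmostDerivation (g : ContextFreeGrammar T) :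
    List (ContextFreeRule T g.NT) → List (Symbol T g.NT) → List (Symbol T g.NT) → Prop
  | refl (u : List (Symbol T g.NT)) : LeftmostDerivation g [] u u
  | step (r : ContextFreeRule T g.NT) (hr : r ∈ g.rules) (x : List T) (y : List (Symbol T g.NT))
      (rs : List (ContextFreeRule T g.NT)) (v : List (Symbol T g.NT))
      (h : LeftmostDerivation g rs (x.map Symbol.terminal ++ r.output ++ y) v) :
      LeftmostDerivation g (r :: rs)
        (x.map Symbol.terminal ++ Symbol.nonterminal r.input :: y) v

/-- A context-free grammar is unambiguous if no sentence has two different leftmost derivations. -/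
def Unambiguous (g : ContextFreeGrammar T) : Prop :=
  ∀ (w : List T) (rs rs' : List (ContextFreeRule T g.NT)),
    LeftmostDerivation g rs [Symbol.nonterminal g.initial] (w.map Symbol.terminal) →
    LeftmostDerivation g rs' [Symbol.nonterminal g.initial] (w.map Symbol.terminal) →
    rs = rs'

/-- A language is inherently ambiguous if no unambiguous context-free grammar generates it. -/
def InherentlyAmbiguous (L : Language T) : Prop :=
  ¬ ∃ g : ContextFreeGrammar T, g.language = L ∧ Unambiguous g

/-- `RunFrom M s w p`: the automaton `M`, started in state `s`, can read `w` through the sequence of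
states `p` and end in an accepting state. -/
inductive RunFrom (M : NFA T σ) : σ → List T → List σ → Prop
  | nil (s : σ) (hs : s ∈ M.accept) : RunFrom M s [] [s]
  | cons (s t : σ) (a : T) (w : List T) (p : List σ) (ht : t ∈ M.step s a)
      (h : RunFrom M t w p) : RunFrom M s (a :: w) (s :: p)

/-- An accepting path of the automaton `M` on the string `w`. -/
def AcceptingPath (M : NFA T σ) (w : List T) (p : List σ) : Prop :=
  ∃ s ∈ M.start, RunFrom M s w p

end Languages

/-! ### DER identifier, length and object identifier octets -/

/-- Big-endian digits of `n` in base `b`. -/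
def digitsBE (b n : ℕ) : List ℕ := (Nat.digits b n).reverse

def toByte (n : ℕ) : Byte := Fin.ofNat 256 n

/-- The length octets of DER: short form below 128, otherwise the long form with the least
number of octets. -/
def lengthOctets (n : ℕ) : List Byte :=
  if n < 128 then [toByte n]
  else toByte (128 + (digitsBE 256 n).length) :: (digitsBE 256 n).map toByte

/-- The length `n` fits the short form, or the long form with at most `k` subsequent octets. -/
def LengthOK (k n : ℕ) : Prop := n < 128 ∨ n < 256 ^ k

/-- Base-128 encoding of one arc of an object identifier: all octets but the last have bit 8 set. -/
def arcOctets (n : ℕ) : List Byte :=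
  if n < 128 then [toByte n]
  else (digitsBE 128 (n / 128)).map (fun d => toByte (128 + d)) ++ [toByte (n % 128)]

/-- Contents octets of the object identifier with the given arcs. -/
def oidOctets : List ℕ → List Byte
  | a :: b :: arcs => arcOctets (40 * a + b) ++ arcs.flatMap arcOctets
  | _ => []

/-- A sequence of complete arcs, each in its shortest base-128 form; `start` says that the next
octet begins a new arc. -/
def arcsOK : Bool → List Byte → Bool
  | start, [] => start
  | start, b :: r => !(start && b == 128) && arcsOK (decide (b < 128)) r

/-- Well-formed DER identifier octets of any class and tag number (the reserved universal tag 0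
excluded): low tag form for tag numbers up to 30, otherwise the shortest high tag form. -/
def identOK : List Byte → Bool
  | [] => false
  | [b] => decide (b.val % 32 ≠ 31) && b != 0 && b != 32
  | b :: c :: r => decide (b.val % 32 = 31) && c != 128 && (!r.isEmpty || decide (31 ≤ c)) &&
      (c :: r).dropLast.all (fun d => decide (128 ≤ d)) &&
      (c :: r).getLast?.any (fun d => decide (d < 128))

/-! ### Contents octets of the primitive types -/

/-- A size constraint `SIZE (lo .. hi)`, where `none` is `MAX`. -/
def sizeOK (lo : ℕ) (hi : Option ℕ) (n : ℕ) : Bool :=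
  decide (lo ≤ n) && hi.all (fun h => decide (n ≤ h))

def anyOctets (_ : List Byte) : Bool := true

def trueOctets (c : List Byte) : Bool := c == [255]

def nullOctets (c : List Byte) : Bool := c.isEmpty

/-- Two's complement in the least number of octets. -/
def integerOctets : List Byte → Bool
  | [] => false
  | [_] => true
  | a :: b :: _ => !(a == 0 && decide (b < 128)) && !(a == 255 && decide (128 ≤ b))

def nonnegOctets (c : List Byte) : Bool :=
  integerOctets c && c.head?.any (fun a => decide (a < 128))

def objectIdOctets (c : List Byte) : Bool := !c.isEmpty && arcsOK true c

/-- The number of unused bits, then the bits, the unused ones being zero. -/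
def bitStringOctets : List Byte → Bool
  | [] => false
  | u :: bs => match bs.getLast? with
    | none => u == 0
    | some b => decide (u < 8) && decide (b.val % 2 ^ u.val = 0)

/-- A bit string with a list of `n` named bits, which DER encodes without trailing zero bits. -/
def namedBitsOctets (n : ℕ) : List Byte → Bool
  | [] => false
  | u :: bs => match bs.getLast? with
    | none => u == 0
    | some b => decide (u < 8) && decide (b.val % 2 ^ (u.val + 1) = 2 ^ u.val) &&
        decide (8 * bs.length ≤ n + u.val)

def isDigit (b : Byte) : Bool := decide (48 ≤ b) && decide (b ≤ 57)

def numericOctets (lo : ℕ) (hi : Option ℕ) (c : List Byte) : Bool :=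
  c.all (fun b => isDigit b || b == 32) && sizeOK lo hi c.length

/-- Letters, digits, space and `' ( ) + , - . / : = ?`. -/
def isPrintable (b : Byte) : Bool :=
  isDigit b || (decide (65 ≤ b) && decide (b ≤ 90)) || (decide (97 ≤ b) && decide (b ≤ 122)) ||
  decide (b ∈ ([32, 39, 40, 41, 43, 44, 45, 46, 47, 58, 61, 63] : List Byte))

def printableOctets (lo : ℕ) (hi : Option ℕ) (c : List Byte) : Bool :=
  c.all isPrintable && sizeOK lo hi c.length

def ia5Octets (lo : ℕ) (hi : Option ℕ) (c : List Byte) : Bool :=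
  c.all (fun b => decide (b < 128)) && sizeOK lo hi c.length

def visibleOctets (lo : ℕ) (hi : Option ℕ) (c : List Byte) : Bool :=
  c.all (fun b => decide (32 ≤ b) && decide (b ≤ 126)) && sizeOK lo hi c.length

def teletexOctets (lo : ℕ) (hi : Option ℕ) (c : List Byte) : Bool := sizeOK lo hi c.length

def bmpOctets (lo : ℕ) (hi : Option ℕ) (c : List Byte) : Bool :=
  decide (c.length % 2 = 0) && sizeOK lo hi (c.length / 2)

def universalOctets (lo : ℕ) (hi : Option ℕ) (c : List Byte) : Bool :=
  decide (c.length % 4 = 0) && sizeOK lo hi (c.length / 4)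

/-- Number of characters of a UTF-8 encoded text, `none` if it is malformed. The first argument is
the number of continuation octets still due, the next of which lies between `lo` and `hi`. -/
def utf8Count : ℕ → Byte → Byte → List Byte → Option ℕ
  | 0, _, _, [] => some 0
  | _ + 1, _, _, [] => none
  | 0, _, _, a :: r =>
      if a < 128 then (utf8Count 0 0 0 r).map (· + 1)
      else if 194 ≤ a ∧ a ≤ 223 then (utf8Count 1 128 191 r).map (· + 1)
      else if a = 224 then (utf8Count 2 160 191 r).map (· + 1)
      else if a = 237 then (utf8Count 2 128 159 r).map (· + 1)
      else if 225 ≤ a ∧ a ≤ 239 then (utf8Count 2 128 191 r).map (· + 1)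
      else if a = 240 then (utf8Count 3 144 191 r).map (· + 1)
      else if 241 ≤ a ∧ a ≤ 243 then (utf8Count 3 128 191 r).map (· + 1)
      else if a = 244 then (utf8Count 3 128 143 r).map (· + 1)
      else none
  | n + 1, lo, hi, a :: r => if lo ≤ a ∧ a ≤ hi then utf8Count n 128 191 r else none

def utf8Octets (lo : ℕ) (hi : Option ℕ) (c : List Byte) : Bool :=
  (utf8Count 0 0 0 c).any (sizeOK lo hi)

def decimal (c : List Byte) : ℕ := c.foldl (fun n b => 10 * n + (b.val - 48)) 0

def daysInMonth (year month : ℕ) : ℕ :=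
  if month = 2 then (if year % 4 = 0 ∧ (year % 100 ≠ 0 ∨ year % 400 = 0) then 29 else 28)
  else if month = 4 ∨ month = 6 ∨ month = 9 ∨ month = 11 then 30 else 31

/-- The eleven octets `MMDDHHMMSSZ` of an existing date in the given year. -/
def dateOctets (year : ℕ) (c : List Byte) : Bool :=
  let f := fun i => decimal ((c.drop (2 * i)).take 2)
  decide (c.length = 11) && (c.take 10).all isDigit && decide (c.drop 10 = [90]) &&
  decide (1 ≤ f 0 ∧ f 0 ≤ 12 ∧ 1 ≤ f 1 ∧ f 1 ≤ daysInMonth year (f 0) ∧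
    f 2 < 24 ∧ f 3 < 60 ∧ f 4 < 60)

/-- `YYMMDDHHMMSSZ`, where `YY` stands for the years from 1950 to 2049. -/
def utcTimeOctets (c : List Byte) : Bool :=
  let y := decimal (c.take 2)
  (c.take 2).all isDigit && dateOctets (if 50 ≤ y then 1900 + y else 2000 + y) (c.drop 2)

/-- `YYYYMMDDHHMMSSZ`. -/
def generalizedTimeOctets (c : List Byte) : Bool :=
  (c.take 4).all isDigit && dateOctets (decimal (c.take 4)) (c.drop 4)

/-! ### Schemas and parse trees -/

/-- Names of certificate fields that label nodes of parse trees. -/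
inductive Field
  | tbsCertificate | signatureAlgorithm | signatureValue
  | version | serialNumber | signature | issuer | validity | subject | subjectPublicKeyInfo
  | issuerUniqueID | subjectUniqueID | extensions
  | extnID | critical | extnValue
  | keyIdentifier
  deriving DecidableEq

/-- Right-hand sides of productions: EBNF operators, terminal strings and DER-encoded types. -/
inductive Schema
  /-- no string at all -/
  | fail
  /-- the empty string -/
  | eps
  /-- a fixed terminal string -/
  | lit (w : List Byte)
  /-- a type with the given identifier octet whose contents octets have no further structure -/
  | prim (ident : Byte) (ok : List Byte → Bool)
  /-- a type with the given identifier octet whose contents octets are parsed by `body` -/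
  | constr (ident : Byte) (body : Schema)
  /-- any single DER-encoded type, its contents octets being left without structure -/
  | any
  /-- concatenation -/
  | seq (a b : Schema)
  /-- alternative -/
  | alt (a b : Schema)
  /-- repetition, zero or more times -/
  | star (a : Schema)
  /-- a named field -/
  | field (f : Field) (a : Schema)

/-- Parse trees. They record the chosen alternatives, the number of repetitions, the division of
the string among the parts of the schema, and the division of each encoded type into identifier,
length and contents octets. -/
inductive Tree
  | leaf (w : List Byte)
  | eps
  | tlv (ident len : List Byte) (contents : Tree)
  | seq (t u : Tree)
  | altL (t : Tree)
  | altR (t : Tree)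
  | starNil
  | starCons (t u : Tree)
  | field (f : Field) (t : Tree)

/-- `Parses k a t w`: the tree `t` is a parse of the byte string `w` according to the schema `a`,
with lengths encoded in at most `k` subsequent length octets. -/
inductive Parses (k : ℕ) : Schema → Tree → List Byte → Prop
  | eps : Parses k .eps .eps []
  | lit (w : List Byte) : Parses k (.lit w) (.leaf w) w
  | prim (ident : Byte) (ok : List Byte → Bool) (v : List Byte)
      (hv : ok v = true) (hl : LengthOK k v.length) :
      Parses k (.prim ident ok) (.tlv [ident] (lengthOctets v.length) (.leaf v))
        ([ident] ++ lengthOctets v.length ++ v)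
  | constr (ident : Byte) (body : Schema) (t : Tree) (v : List Byte)
      (hv : Parses k body t v) (hl : LengthOK k v.length) :
      Parses k (.constr ident body) (.tlv [ident] (lengthOctets v.length) t)
        ([ident] ++ lengthOctets v.length ++ v)
  | any (i v : List Byte) (hi : identOK i = true) (hl : LengthOK k v.length) :
      Parses k .any (.tlv i (lengthOctets v.length) (.leaf v)) (i ++ lengthOctets v.length ++ v)
  | seq (a b : Schema) (t u : Tree) (v w : List Byte) (ha : Parses k a t v)
      (hb : Parses k b u w) : Parses k (.seq a b) (.seq t u) (v ++ w)
  | altL (a b : Schema) (t : Tree) (w : List Byte) (h : Parses k a t w) :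
      Parses k (.alt a b) (.altL t) w
  | altR (a b : Schema) (t : Tree) (w : List Byte) (h : Parses k b t w) :
      Parses k (.alt a b) (.altR t) w
  | starNil (a : Schema) : Parses k (.star a) .starNil []
  | starCons (a : Schema) (t u : Tree) (v w : List Byte) (ha : Parses k a t v)
      (hs : Parses k (.star a) u w) : Parses k (.star a) (.starCons t u) (v ++ w)
  | field (f : Field) (a : Schema) (t : Tree) (w : List Byte) (h : Parses k a t w) :
      Parses k (.field f a) (.field f t) w

namespace Tree

/-- The byte string at the leaves of a parse tree. -/
def yield : Tree → List Byte
  | leaf w => w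
  | eps => []
  | tlv i l t => i ++ l ++ t.yield
  | seq t u => t.yield ++ u.yield
  | altL t => t.yield
  | altR t => t.yield
  | starNil => []
  | starCons t u => t.yield ++ u.yield
  | field _ t => t.yield

/-- The encodings of all occurrences of the field `f`, from left to right. -/
def fields (f : Field) : Tree → List (List Byte)
  | leaf _ => []
  | eps => []
  | tlv _ _ t => t.fields f
  | seq t u => t.fields f ++ u.fields f
  | altL t => t.fields f
  | altR t => t.fields f
  | starNil => []
  | starCons t u => t.fields f ++ u.fields f
  | field g t => (if g = f then [t.yield] else []) ++ t.fields f

end Tree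

/-! ### Derived constructs of ASN.1 -/

namespace Schema

def seqs (l : List Schema) : Schema := l.foldr seq eps

def choice (l : List Schema) : Schema := l.foldr alt fail

def opt (a : Schema) : Schema := alt a eps

def plus (a : Schema) : Schema := seq a (star a)

/-- At most `n` repetitions. -/
def upTo : ℕ → Schema → Schema
  | 0, _ => eps
  | n + 1, a => opt (seq a (upTo n a))

/-- Between 1 and `n + 1` repetitions. -/
def oneUpTo (n : ℕ) (a : Schema) : Schema := seq a (upTo n a)

end Schema

open Schema

/-- `SEQUENCE { ... }`. -/
def sequence (l : List Schema) : Schema := .constr 0x30 (seqs l)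

/-- `SEQUENCE OF`, `SEQUENCE SIZE (1..MAX) OF`, `SET OF` and `SET SIZE (1..MAX) OF`. -/
def sequenceOf (a : Schema) : Schema := .constr 0x30 (star a)
def sequenceOf1 (a : Schema) : Schema := .constr 0x30 (plus a)
def setOf (a : Schema) : Schema := .constr 0x31 (star a)
def setOf1 (a : Schema) : Schema := .constr 0x31 (plus a)

def boolTrue : Schema := .prim 0x01 trueOctets
def integer : Schema := .prim 0x02 integerOctets
def nonneg : Schema := .prim 0x02 nonnegOctets
def bitString : Schema := .prim 0x03 bitStringOctets
def octetString : Schema := .prim 0x04 anyOctets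
def null : Schema := .prim 0x05 nullOctets
def objectId : Schema := .prim 0x06 objectIdOctets
def numericString (lo : ℕ) (hi : Option ℕ) : Schema := .prim 0x12 (numericOctets lo hi)
def printableString (lo : ℕ) (hi : Option ℕ) : Schema := .prim 0x13 (printableOctets lo hi)
def ia5String (lo : ℕ) (hi : Option ℕ) : Schema := .prim 0x16 (ia5Octets lo hi)

/-- The object identifier with exactly the given arcs. -/
def thisOid (arcs : List ℕ) : Schema := .prim 0x06 (fun c => c == oidOctets arcs)

/-- Any well-formed object identifier other than the listed ones. -/
def otherOid (l : List (List ℕ)) : Schema :=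
  .prim 0x06 (fun c => objectIdOctets c && l.all (fun arcs => c != oidOctets arcs))

/-- A `BIT STRING`, which DER marks as primitive, holding the encoding of a value of type `a`. -/
def bitStringContaining (a : Schema) : Schema := .constr 0x03 (.seq (.lit [0]) a)

/-- An `OCTET STRING`, which DER marks as primitive, holding the encoding of a value of type `a`. -/
def octetStringContaining (a : Schema) : Schema := .constr 0x04 a

/-! ### Algorithm identifiers

In DER a component that equals its `DEFAULT` value is not encoded; accordingly such a component is
optional and, where it is present, differs from the default. -/

/-- A standardized algorithm: its object identifier, the syntax of its parameters, and the syntax of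
the `BIT STRING` (signature value or public key) that goes with it. -/
structure Algorithm where
  oid : List ℕ
  params : Schema
  value : Schema

def Algorithm.identifier (a : Algorithm) : Schema := sequence [thisOid a.oid, a.params]

def rsadsi (n : ℕ) : List ℕ := [1, 2, 840, 113549, 1, 1, n]

/-- Identifier of SHA-224, SHA-256, SHA-384 or SHA-512, with `NULL` or absent parameters. -/
def hashIdentifier : Schema :=
  choice ([4, 1, 2, 3].map fun n => sequence [thisOid [2, 16, 840, 1, 101, 3, 4, 2, n], opt null])

def mgf1Identifier : Schema := sequence [thisOid (rsadsi 8), hashIdentifier]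

def pssParams : Schema := sequence [
  opt (.constr 0xA0 hashIdentifier),
  opt (.constr 0xA1 mgf1Identifier),
  opt (.constr 0xA2 (.prim 0x02 fun c => integerOctets c && c != [20])),
  opt (.constr 0xA3 (.prim 0x02 fun c => integerOctets c && c != [1]))]

def oaepParams : Schema := sequence [
  opt (.constr 0xA0 hashIdentifier),
  opt (.constr 0xA1 mgf1Identifier),
  opt (.constr 0xA2 (sequence [thisOid (rsadsi 9), .prim 0x04 fun c => !c.isEmpty]))]

/-- `SEQUENCE { r INTEGER, s INTEGER }`. -/
def dssSigValue : Schema := sequence [integer, integer]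

/-- The standardized signature algorithms. -/
def signatureAlgorithms : List Algorithm :=
  -- RSA PKCS #1 v1.5 with MD2, MD5, SHA-1, SHA-256, SHA-384, SHA-512, SHA-224
  ([2, 4, 5, 11, 12, 13, 14].map fun n => ⟨rsadsi n, null, bitString⟩) ++
  -- RSASSA-PSS
  [⟨rsadsi 10, pssParams, bitString⟩] ++
  -- DSA with SHA-1, SHA-224, SHA-256
  ([[1, 2, 840, 10040, 4, 3], [2, 16, 840, 1, 101, 3, 4, 3, 1],
    [2, 16, 840, 1, 101, 3, 4, 3, 2]].map fun o => ⟨o, .eps, bitStringContaining dssSigValue⟩) ++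
  -- ECDSA with SHA-1, SHA-224, SHA-256, SHA-384, SHA-512
  ([[1, 2, 840, 10045, 4, 1], [1, 2, 840, 10045, 4, 3, 1], [1, 2, 840, 10045, 4, 3, 2],
    [1, 2, 840, 10045, 4, 3, 3], [1, 2, 840, 10045, 4, 3, 4]].map
      fun o => ⟨o, .eps, bitStringContaining dssSigValue⟩) ++
  -- GOST R 34.11-94 with GOST R 34.10-2001 and with GOST R 34.10-94
  ([3, 4].map fun n => ⟨[1, 2, 643, 2, 2, n], .eps, bitString⟩)

def rsaPublicKey : Schema := sequence [integer, integer]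

def dssParams : Schema := sequence [integer, integer, integer]

/-- Diffie-Hellman: `p`, `g`, `q`, optional `j`, optional validation parameters. -/
def dhParams : Schema := sequence [integer, integer, integer, opt integer,
  opt (sequence [bitString, integer])]

def gostParams : Schema := choice [sequence [objectId, objectId, opt objectId], null, .eps]

/-- The standardized public key algorithms. -/
def publicKeyAlgorithms : List Algorithm := [
  -- RSA encryption, RSASSA-PSS, RSAES-OAEP
  ⟨rsadsi 1, null, bitStringContaining rsaPublicKey⟩,
  ⟨rsadsi 10, opt pssParams, bitStringContaining rsaPublicKey⟩,
  ⟨rsadsi 7, oaepParams, bitStringContaining rsaPublicKey⟩,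
  -- DSA, Diffie-Hellman, KEA
  ⟨[1, 2, 840, 10040, 4, 1], opt dssParams, bitStringContaining integer⟩,
  ⟨[1, 2, 840, 10046, 2, 1], dhParams, bitStringContaining integer⟩,
  ⟨[2, 16, 840, 1, 101, 2, 1, 1, 22], octetString, bitString⟩,
  -- elliptic curve keys (unrestricted, ECDH, ECMQV) over a named curve
  ⟨[1, 2, 840, 10045, 2, 1], objectId, bitString⟩,
  ⟨[1, 3, 132, 1, 12], objectId, bitString⟩,
  ⟨[1, 3, 132, 1, 13], objectId, bitString⟩,
  -- GOST R 34.10-94 and GOST R 34.10-2001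
  ⟨[1, 2, 643, 2, 2, 20], gostParams, bitStringContaining octetString⟩,
  ⟨[1, 2, 643, 2, 2, 19], gostParams, bitStringContaining octetString⟩]

/-! ### Names -/

def directoryString (hi : Option ℕ) : Schema := choice [
  .prim 0x14 (teletexOctets 1 hi), .prim 0x13 (printableOctets 1 hi),
  .prim 0x1C (universalOctets 1 hi), .prim 0x0C (utf8Octets 1 hi), .prim 0x1E (bmpOctets 1 hi)]

/-- The naming attributes with a standardized value syntax. -/
def namingAttributes : List (List ℕ × Schema) := [
  -- name, surname, given name, initials, generation qualifier
  ([2, 5, 4, 41], directoryString (some 32768)), ([2, 5, 4, 4], directoryString (some 32768)),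
  ([2, 5, 4, 42], directoryString (some 32768)), ([2, 5, 4, 43], directoryString (some 32768)),
  ([2, 5, 4, 44], directoryString (some 32768)),
  -- common name, locality, state or province, organization, organizational unit
  ([2, 5, 4, 3], directoryString (some 64)), ([2, 5, 4, 7], directoryString (some 128)),
  ([2, 5, 4, 8], directoryString (some 128)), ([2, 5, 4, 10], directoryString (some 64)),
  ([2, 5, 4, 11], directoryString (some 64)),
  -- title, DN qualifier, country, serial number, pseudonym
  ([2, 5, 4, 12], directoryString (some 64)), ([2, 5, 4, 46], printableString 0 none),
  ([2, 5, 4, 6], printableString 2 (some 2)), ([2, 5, 4, 5], printableString 1 (some 64)),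
  ([2, 5, 4, 65], directoryString (some 128)),
  -- domain component, e-mail address
  ([0, 9, 2342, 19200300, 100, 1, 25], ia5String 0 none),
  ([1, 2, 840, 113549, 1, 9, 1], ia5String 1 (some 255))]

def attributeTypeAndValue : Schema := choice
  ((namingAttributes.map fun p => sequence [thisOid p.1, p.2]) ++
    [sequence [otherOid (namingAttributes.map Prod.fst), .any]])

def relativeDN : Schema := setOf1 attributeTypeAndValue

def name : Schema := sequenceOf relativeDN

/-- The issuer has at least one relative distinguished name. -/
def nonemptyName : Schema := sequenceOf1 relativeDN

/-! ### General names -/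

def numericOrPrintable (lo : ℕ) (hi : Option ℕ) : Schema :=
  choice [numericString lo hi, printableString lo hi]

/-- X.400 address; the components of the `SET` follow the order of their tags, as DER requires. -/
def orAddressBody : Schema := seqs [
  sequence [
    opt (.constr 0x61 (choice [numericString 3 (some 3), printableString 2 (some 2)])),
    opt (.constr 0x62 (numericOrPrintable 0 (some 16))),
    opt (.prim 0x80 (numericOctets 1 (some 16))),
    opt (.prim 0x81 (printableOctets 1 (some 24))),
    opt (.constr 0xA2 (numericOrPrintable 1 (some 16))),
    opt (.prim 0x83 (printableOctets 1 (some 64))),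
    opt (.prim 0x84 (numericOctets 1 (some 32))),
    opt (.constr 0xA5 (seqs [.prim 0x80 (printableOctets 1 (some 40)),
      opt (.prim 0x81 (printableOctets 1 (some 16))),
      opt (.prim 0x82 (printableOctets 1 (some 5))),
      opt (.prim 0x83 (printableOctets 1 (some 3)))])),
    opt (.constr 0xA6 (oneUpTo 3 (printableString 1 (some 32))))],
  opt (.constr 0x30 (oneUpTo 3
    (sequence [printableString 1 (some 8), printableString 1 (some 128)]))),
  opt (.constr 0x31 (oneUpTo 255
    (sequence [.prim 0x80 (fun c => nonnegOctets c && (decide (c.length ≤ 1) || c == [1, 0] ||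
      (decide (c.length = 2) && c.head? == some 0))), .constr 0xA1 .any])))]

def generalName : Schema := choice [
  .constr 0xA0 (seqs [objectId, .constr 0xA0 .any]),
  .prim 0x81 (ia5Octets 0 none),
  .prim 0x82 (ia5Octets 0 none),
  .constr 0xA3 orAddressBody,
  .constr 0xA4 name,
  .constr 0xA5 (seqs [opt (.constr 0xA0 (directoryString none)),
    .constr 0xA1 (directoryString none)]),
  .prim 0x86 (ia5Octets 0 none),
  .prim 0x87 anyOctets,
  .prim 0x88 objectIdOctets]

def generalNames : Schema := sequenceOf1 generalName

/-! ### Extensions -/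

def authorityKeyIdentifier : Schema := sequence [
  opt (.field .keyIdentifier (.prim 0x80 anyOctets)),
  opt (.constr 0xA1 (plus generalName)),
  opt (.prim 0x82 integerOctets)]

def keyUsage : Schema := .prim 0x03 (namedBitsOctets 9)

def displayText : Schema := choice [
  .prim 0x16 (ia5Octets 1 (some 200)), .prim 0x1A (visibleOctets 1 (some 200)),
  .prim 0x1E (bmpOctets 1 (some 200)), .prim 0x0C (utf8Octets 1 (some 200))]

/-- Policy qualifiers: pointer to a practice statement, or user notice. -/
def policyQualifierInfo : Schema := choice [
  sequence [thisOid [1, 3, 6, 1, 5, 5, 7, 2, 1], ia5String 0 none],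
  sequence [thisOid [1, 3, 6, 1, 5, 5, 7, 2, 2],
    sequence [opt (sequence [displayText, sequenceOf integer]), opt displayText]]]

def certificatePolicies : Schema :=
  sequenceOf1 (sequence [objectId, opt (sequenceOf1 policyQualifierInfo)])

def policyMappings : Schema := sequenceOf1 (sequence [objectId, objectId])

def subjectDirectoryAttributes : Schema := sequenceOf1 (sequence [objectId, setOf1 .any])

def basicConstraints : Schema := sequence [opt boolTrue, opt nonneg]

def generalSubtrees : Schema := plus (sequence [generalName,
  opt (.prim 0x80 fun c => nonnegOctets c && c != [0]), opt (.prim 0x81 nonnegOctets)])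

def nameConstraints : Schema := sequence [
  opt (.constr 0xA0 generalSubtrees), opt (.constr 0xA1 generalSubtrees)]

def policyConstraints : Schema := sequence [
  opt (.prim 0x80 nonnegOctets), opt (.prim 0x81 nonnegOctets)]

def crlDistributionPoints : Schema := sequenceOf1 (sequence [
  opt (.constr 0xA0 (choice [.constr 0xA0 (plus generalName),
    .constr 0xA1 (plus attributeTypeAndValue)])),
  opt (.prim 0x81 (namedBitsOctets 9)),
  opt (.constr 0xA2 (plus generalName))])

def infoAccess : Schema := sequenceOf1 (sequence [objectId, generalName])

/-- The 17 standardized extensions. -/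
def standardExtensions : List (List ℕ × Schema) := [
  ([2, 5, 29, 35], authorityKeyIdentifier),
  -- subject key identifier
  ([2, 5, 29, 14], octetString),
  ([2, 5, 29, 15], keyUsage),
  ([2, 5, 29, 32], certificatePolicies),
  ([2, 5, 29, 33], policyMappings),
  -- subject and issuer alternative name
  ([2, 5, 29, 17], generalNames),
  ([2, 5, 29, 18], generalNames),
  ([2, 5, 29, 9], subjectDirectoryAttributes),
  ([2, 5, 29, 19], basicConstraints),
  ([2, 5, 29, 30], nameConstraints),
  ([2, 5, 29, 36], policyConstraints),
  -- extended key usage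
  ([2, 5, 29, 37], sequenceOf1 objectId),
  ([2, 5, 29, 31], crlDistributionPoints),
  -- inhibit any-policy
  ([2, 5, 29, 54], nonneg),
  -- freshest CRL
  ([2, 5, 29, 46], crlDistributionPoints),
  -- authority and subject information access
  ([1, 3, 6, 1, 5, 5, 7, 1, 1], infoAccess),
  ([1, 3, 6, 1, 5, 5, 7, 1, 11], infoAccess)]

def extensionWith (oid value : Schema) : Schema := sequence [
  .field .extnID oid, opt (.field .critical boolTrue), .field .extnValue value]

/-- An extension is parsed according to its object identifier if that is a standardized one; the
value of any other extension is an octet string without further structure. -/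
def extension : Schema := choice
  ((standardExtensions.map fun p => extensionWith (thisOid p.1) (octetStringContaining p.2)) ++
    [extensionWith (otherOid (standardExtensions.map Prod.fst)) octetString])

/-! ### Certificates -/

def time : Schema := choice [.prim 0x17 utcTimeOctets, .prim 0x18 generalizedTimeOctets]

/-- The public key is parsed according to the object identifier of its algorithm. -/
def subjectPublicKeyInfo : Schema := choice
  (publicKeyAlgorithms.map fun a => sequence [a.identifier, a.value])

def versionEncoding (n : Byte) : List Byte := [0xA0, 3, 2, 1, n]

/-- `version` has default v1 and is therefore encoded for v2 and v3 only. -/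
def tbsCertificate : Schema := sequence [
  opt (.field .version (.constr 0xA0 (.prim 0x02 fun c => c == [1] || c == [2]))),
  .field .serialNumber integer,
  .field .signature (choice (signatureAlgorithms.map Algorithm.identifier)),
  .field .issuer nonemptyName,
  .field .validity (sequence [time, time]),
  .field .subject name,
  .field .subjectPublicKeyInfo subjectPublicKeyInfo,
  opt (.field .issuerUniqueID (.prim 0x81 bitStringOctets)),
  opt (.field .subjectUniqueID (.prim 0x82 bitStringOctets)),
  opt (.field .extensions (.constr 0xA3 (sequenceOf1 extension)))]

/-- The signature value is parsed according to the object identifier of the signature algorithm. -/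
def certificate : Schema := sequence [
  .field .tbsCertificate tbsCertificate,
  choice (signatureAlgorithms.map fun a =>
    .seq (.field .signatureAlgorithm a.identifier) (.field .signatureValue a.value))]

/-! ### The languages -/

/-- The byte strings that have a parse as a certificate which satisfies `P`. -/
def certificatesWith (k : ℕ) (P : Tree → Prop) : Language Byte :=
  {w | ∃ t, Parses k certificate t w ∧ P t}

/-- No two extensions have the same object identifier. -/
def DistinctExtensions (t : Tree) : Prop := (t.fields .extnID).Nodup

/-- Unique identifiers require version 2 or 3, extensions require version 3. -/
def VersionOK (t : Tree) : Prop :=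
  (t.fields .issuerUniqueID ≠ [] ∨ t.fields .subjectUniqueID ≠ [] → t.fields .version ≠ []) ∧
  (t.fields .extensions ≠ [] → t.fields .version = [versionEncoding 2])

/-- The algorithm identifiers inside and outside the signed part are equal. -/
def AlgorithmsMatch (t : Tree) : Prop := t.fields .signature = t.fields .signatureAlgorithm

/-- If subject and issuer are equal, the key identifier of the authority key identifier extension
is present. -/
def SelfIssuedOK (t : Tree) : Prop :=
  t.fields .subject = t.fields .issuer → t.fields .keyIdentifier ≠ []

/-- The first-stage language. Besides the certificate schema, the distinctness of extensions and
the version rules, it takes into account any language `R` of further constraints. -/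
def LReg (k : ℕ) (R : Language Byte) : Language Byte :=
  certificatesWith k DistinctExtensions ⊓ certificatesWith k VersionOK ⊓ R

def LAIdMatch (k : ℕ) : Language Byte := certificatesWith k AlgorithmsMatch

def LSIMatch (k : ℕ) : Language Byte := certificatesWith k SelfIssuedOK

/-- The restricted X.509 language. -/
def LX509r2 (k : ℕ) (R : Language Byte) : Language Byte :=
  LAIdMatch k ⊓ LSIMatch k ⊓ LReg k R

end X509

namespace X509

/-! ### Finite languages -/

section FiniteLanguages

variable {T : Type*} {σ : Type*}

open ContextFreeGrammar

/-! A certificate is one DER element whose length field has at most `k` subsequent octets, so its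
size is bounded (`exists_length_le_of_parses_certificate`). Hence `LReg k R` is finite whatever `R`
is. Finiteness gives both formal-language claims: the grammar with one production per word is
unambiguous (`not_inherentlyAmbiguous_of_finite`), and a language of bounded word length has
finitely many left quotients, so a DFA accepts it (`isRegular_of_length_le`).

The substance is uniqueness of parses, `determined_certificate`. It is an LL(1)-style argument over
schemas. `Determined k a S` is stable under the schema operators as long as options and repetitions
are resolved by the next octet, which is compared with first sets and with the set `S` of possible
followers. Two facts go beyond LL(1). Identifier and length octets form prefix codes, so an encoded
type fixes its own end and its body is parsed with nothing following (`Determined.constr`). Branches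
that all begin with the same SEQUENCE octet are distinguished by the object identifier at their
head: this is `Separated`, which needs only that the encoded identifiers are distinct.

Once parses are unique, the parses witnessing the separate conditions are the same tree, and the
remaining claims follow. -/

theorem map_terminal_injective {N : Type*} :
    Function.Injective (List.map (Symbol.terminal : T → Symbol T N)) :=
  List.map_injective_iff.2 fun _ _ h => Symbol.terminal.inj h

/-- The grammar with a single nonterminal and one production for each word of `s`. -/
def wordsGrammar (s : Finset (List T)) : ContextFreeGrammar T where
  NT := Unit
  initial := ()
  rules := s.map ⟨fun w => ⟨(), w.map Symbol.terminal⟩, fun _ _ h =>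
    map_terminal_injective (congrArg ContextFreeRule.output h)⟩

theorem mem_wordsGrammar_rules {s : Finset (List T)}
    {r : ContextFreeRule T (wordsGrammar s).NT} :
    r ∈ (wordsGrammar s).rules ↔ ∃ w ∈ s, r.output = w.map Symbol.terminal := by
  refine Finset.mem_map.trans (exists_congr fun w => and_congr_right fun _ => ?_)
  constructor
  · rintro rfl
    rfl
  · intro h
    exact ContextFreeRule.ext rfl h.symm

/-- A step needs a nonterminal to rewrite, and a terminal string has none. -/
theorem LeftmostDerivation.eq_of_terminal {g : ContextFreeGrammar T} {w : List T}
    {rs : List (ContextFreeRule T g.NT)} {u v : List (Symbol T g.NT)}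
    (h : LeftmostDerivation g rs u v) (hu : u = w.map Symbol.terminal) : rs = [] ∧ v = u := by
  cases h with
  | refl => exact ⟨rfl, rfl⟩
  | step r hr x y rs v h =>
    have : Symbol.nonterminal r.input ∈ w.map (Symbol.terminal : T → Symbol T g.NT) := by
      rw [← hu]; simp
    simp at this

/-- Every right-hand side is terminal, so a derivation stops after one rule, and the derived word
identifies that rule. -/
theorem wordsGrammar_leftmostDerivation {s : Finset (List T)} {w : List T}
    {rs : List (ContextFreeRule T (wordsGrammar s).NT)}
    (h : LeftmostDerivation (wordsGrammar s) rs [Symbol.nonterminal (wordsGrammar s).initial]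
      (w.map Symbol.terminal)) :
    rs = [⟨(), w.map Symbol.terminal⟩] := by
  generalize hu : [Symbol.nonterminal (wordsGrammar s).initial] = u at h
  generalize hz : w.map Symbol.terminal = z at h
  cases h with
  | refl =>
    subst hu
    cases w with
    | nil => simp at hz
    | cons a w => simp at hz
  | step r hr x y rs v h =>
    have hx : x = [] := by
      cases x with
      | nil => rfl
      | cons a x => simp at hu
    subst hx
    have hy : y = [] := by simpa using (List.cons.inj hu).2.symm
    subst hy
    obtain ⟨w', -, hw'⟩ := mem_wordsGrammar_rules.1 hr
    obtain ⟨rfl, rfl⟩ := h.eq_of_terminal (w := w') (by simp [hw'])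
    exact congrArg (fun r => [r]) (ContextFreeRule.ext rfl (by simp [hw']))

theorem unambiguous_wordsGrammar (s : Finset (List T)) : Unambiguous (wordsGrammar s) := by
  intro w rs rs' h h'
  rw [wordsGrammar_leftmostDerivation h, wordsGrammar_leftmostDerivation h']

theorem language_wordsGrammar (s : Finset (List T)) :
    (wordsGrammar s).language = {w | w ∈ s} := by
  ext w
  rw [mem_language_iff]
  constructor
  · intro h
    rcases h.cases_head with h | ⟨u, hu, h⟩
    · cases w <;> simp at h
    · obtain ⟨r, hr, hru⟩ := hu
      obtain ⟨w', hw', ho⟩ := mem_wordsGrammar_rules.1 hr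
      obtain ⟨p, q, hpq, rfl⟩ := hru.exists_parts
      have hp : p = [] ∧ q = [] := by
        have := congrArg List.length hpq
        simp at this
        exact ⟨List.length_eq_zero_iff.1 (by omega), List.length_eq_zero_iff.1 (by omega)⟩
      obtain ⟨rfl, rfl⟩ := hp
      have hw : w = w' := by
        rcases h.cases_head with h | ⟨v, ⟨r, -, hrv⟩, -⟩
        · exact map_terminal_injective (by simpa [ho] using h.symm)
        · have := hrv.nonterminal_input_mem
          simp [ho] at this
      subst hw
      exact hw'
  · intro h
    refine Produces.single ⟨⟨(), w.map Symbol.terminal⟩, mem_wordsGrammar_rules.2 ⟨w, h, rfl⟩, ?_⟩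
    exact ContextFreeRule.Rewrites.input_output

/-- A finite language is not inherently ambiguous. -/
theorem not_inherentlyAmbiguous_of_finite {L : Language T} (hL : Set.Finite {w | w ∈ L}) :
    ¬ InherentlyAmbiguous L := by
  rw [InherentlyAmbiguous, not_not]
  refine ⟨wordsGrammar hL.toFinset, ?_, unambiguous_wordsGrammar _⟩
  rw [language_wordsGrammar]
  ext w
  exact hL.mem_toFinset

/-- A language of words of bounded length over a finite alphabet is regular. -/
theorem isRegular_of_length_le {T : Type} [Finite T] {L : Language T} (N : ℕ)
    (hL : ∀ w ∈ L, w.length ≤ N) : L.IsRegular := by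
  -- Myhill–Nerode: every left quotient is a subset of the finite set of words of length at most
  -- `N`, so there are only finitely many quotients.
  refine .of_finite_range_leftQuotient ?_
  refine (List.finite_length_le T N).finite_subsets.subset ?_
  rintro _ ⟨x, rfl⟩ y hy
  have := hL _ ((Language.mem_leftQuotient x y).1 hy)
  simp only [List.length_append] at this
  exact Nat.le_of_add_left_le this

theorem RunFrom.eq_of_toNFA {M : DFA T σ} {s : σ} {w : List T} {p q : List σ}
    (hp : RunFrom M.toNFA s w p) (hq : RunFrom M.toNFA s w q) : p = q := by
  induction hp generalizing q with
  | nil s hs => cases hq; rfl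
  | cons s t a w p ht h ih =>
    cases hq with
    | cons _ t' _ _ q ht' h' =>
      -- The successor sets of `M.toNFA` are singletons, so membership is definitionally an
      -- equation.
      have e : t = t' := (show t = M.step s a from ht).trans (show t' = M.step s a from ht').symm
      subst e
      rw [ih h']

theorem exists_runFrom_of_mem_acceptsFrom {M : DFA T σ} {s : σ} {w : List T}
    (h : w ∈ M.acceptsFrom s) : ∃ p, RunFrom M.toNFA s w p := by
  induction w generalizing s with
  | nil => exact ⟨_, .nil s h⟩
  | cons a w ih =>
    obtain ⟨p, hp⟩ := ih (s := M.step s a) h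
    exact ⟨_, .cons s _ a w p rfl hp⟩

/-- A deterministic automaton has exactly one accepting path on each accepted word. -/
theorem existsUnique_acceptingPath {M : DFA T σ} {w : List T} (h : w ∈ M.accepts) :
    ∃! p : List σ, AcceptingPath M.toNFA w p := by
  obtain ⟨p, hp⟩ := exists_runFrom_of_mem_acceptsFrom h
  refine ⟨p, ⟨M.start, rfl, hp⟩, ?_⟩
  rintro q ⟨s, hs, hq⟩
  obtain rfl : s = M.start := hs
  exact hq.eq_of_toNFA hp

end FiniteLanguages

/-! ### Prefix codes for lengths and identifiers -/

theorem toByte_val {n : ℕ} (h : n < 256) : (toByte n).val = n := Nat.mod_eq_of_lt h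

theorem map_toByte_injOn {l m : List ℕ} (hl : ∀ d ∈ l, d < 256) (hm : ∀ d ∈ m, d < 256)
    (h : l.map toByte = m.map toByte) : l = m := by
  have key : ∀ l : List ℕ, (∀ d ∈ l, d < 256) → (l.map toByte).map Fin.val = l := by
    intro l hl
    rw [List.map_map]
    exact (List.map_congr_left fun d hd => toByte_val (hl d hd)).trans (List.map_id l)
  rw [← key l hl, h, key m hm]

theorem length_digitsBE_le {k n : ℕ} (h : n < 256 ^ k) : (digitsBE 256 n).length ≤ k := by
  rw [digitsBE, List.length_reverse]
  exact (Nat.digits_length_le_iff (by norm_num) n).2 h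

/-- Length octets are self-delimiting. The first octet is below 128 in the short form; in the long
form it is 128 plus the number of digits. With `k ≤ 126` this sum stays below 256, so `toByte` does
not wrap around and the digit count can be read back. -/
theorem lengthOctets_inj_of_append {k n m : ℕ} (hk : k ≤ 126) (hn : LengthOK k n) (hm : LengthOK k m)
    {x y : List Byte} (h : lengthOctets n ++ x = lengthOctets m ++ y) : n = m := by
  have long : ∀ n, LengthOK k n → ¬ n < 128 →
      (toByte (128 + (digitsBE 256 n).length)).val = 128 + (digitsBE 256 n).length := by
    intro n hn h
    refine toByte_val ?_
    have := length_digitsBE_le (hn.resolve_left h)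
    omega
  have hdig : ∀ n, ∀ d ∈ digitsBE 256 n, d < 256 := by
    intro n d hd
    exact Nat.digits_lt_base (by norm_num) (List.mem_reverse.1 hd)
  unfold lengthOctets at h
  split_ifs at h with h1 h2 h2
  · have := congrArg Fin.val (List.cons.inj h).1
    rwa [toByte_val (by omega), toByte_val (by omega)] at this
  · have := congrArg Fin.val (List.cons.inj h).1
    rw [toByte_val (by omega), long m hm h2] at this
    omega
  · have := congrArg Fin.val (List.cons.inj h).1
    rw [toByte_val (n := m) (by omega), long n hn h1] at this
    omega
  · have := congrArg Fin.val (List.cons.inj h).1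
    rw [long m hm h2, long n hn h1] at this
    -- Equal first octets give equal digit counts, so the two digit blocks can be cut off at the
    -- same place.
    have h3 := (List.append_inj (List.cons.inj h).2 (by simp; omega)).1
    have h4 := map_toByte_injOn (hdig n) (hdig m) h3
    exact Nat.digits_inj_iff.1 (List.reverse_injective h4)

theorem lengthOctets_append_inj {k : ℕ} (hk : k ≤ 126) {v v' x x' : List Byte}
    (hv : LengthOK k v.length) (hv' : LengthOK k v'.length)
    (h : lengthOctets v.length ++ v ++ x = lengthOctets v'.length ++ v' ++ x') :
    v = v' ∧ x = x' := by
  rw [List.append_assoc, List.append_assoc] at h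
  have hl := lengthOctets_inj_of_append hk hv hv' h
  rw [hl] at h
  exact List.append_inj (List.append_cancel_left h) hl

/-- The block ends at its first octet below 128, so what follows cannot shift its end. -/
theorem base128_inj_of_append {l m x y : List Byte}
    (hl : l.dropLast.all (fun d => decide (128 ≤ d)) = true)
    (hl' : l.getLast?.any (fun d => decide (d < 128)) = true)
    (hm : m.dropLast.all (fun d => decide (128 ≤ d)) = true)
    (hm' : m.getLast?.any (fun d => decide (d < 128)) = true)
    (h : l ++ x = m ++ y) : l = m := by
  induction l generalizing m with
  | nil => simp at hl'
  | cons a l ih =>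
    cases m with
    | nil => simp at hm'
    | cons b m =>
      obtain ⟨rfl, hlm⟩ := List.cons.inj h
      cases l with
      | nil =>
        cases m with
        | nil => rfl
        | cons c m =>
          simp at hl' hm
          exact absurd hl' (not_lt.2 hm.1)
      | cons c l =>
        cases m with
        | nil =>
          simp at hl hm'
          exact absurd hm' (not_lt.2 hl.1)
        | cons d m =>
          rw [List.dropLast_cons_cons, List.all_cons, Bool.and_eq_true] at hl hm
          rw [List.getLast?_cons_cons] at hl' hm'
          rw [ih hl.2 hl' hm.2 hm' hlm]

/-- The low five bits of the first octet choose between the one-octet form and the high tag form; in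
the latter the continuation bits mark the end. -/
theorem identOK_inj_of_append {i j x y : List Byte} (hi : identOK i = true) (hj : identOK j = true)
    (h : i ++ x = j ++ y) : i = j := by
  match i, j, hi, hj, h with
  | [b], [c], _, _, h => rw [(List.cons.inj h).1]
  | [b], c :: d :: r, hi, hj, h =>
    obtain ⟨rfl, -⟩ := List.cons.inj h
    simp [identOK] at hi hj
    exact absurd hj.1.1.1.1 hi.1.1
  | c :: d :: r, [b], hi, hj, h =>
    obtain ⟨rfl, -⟩ := List.cons.inj h
    simp [identOK] at hi hj
    exact absurd hi.1.1.1.1 hj.1.1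
  | b :: c :: r, b' :: c' :: r', hi, hj, h =>
    obtain ⟨rfl, hr⟩ := List.cons.inj h
    simp only [identOK, Bool.and_eq_true] at hi hj
    rw [base128_inj_of_append hi.1.2 hi.2 hj.1.2 hj.2 hr]

open Schema

/-! ### First octets -/

namespace Schema

/-- Whether a schema may match the empty string. -/
def nullable : Schema → Bool
  | fail => false
  | eps => true
  | lit w => w.isEmpty
  | prim _ _ => false
  | constr _ _ => false
  | any => false
  | seq a b => a.nullable && b.nullable
  | alt a b => a.nullable || b.nullable
  | star _ => true
  | field _ a => a.nullable

/-- The octets with which a match of a schema may begin. -/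
def first : Schema → List Byte
  | fail => []
  | eps => []
  | lit w => w.head?.toList
  | prim i _ => [i]
  | constr i _ => [i]
  | any => List.finRange 256
  | seq a b => a.first ++ if a.nullable then b.first else []
  | alt a b => a.first ++ b.first
  | star a => a.first
  | field _ a => a.first

/-- The octets with which a match of a schema may begin if it is followed by a string that is empty
or begins with an octet of `S`. -/
def firstWith (a : Schema) (S : List Byte) : List Byte :=
  a.first ++ if a.nullable then S else []

end Schema

/-- The string is empty or begins with an octet of `S`. -/
def StartsIn (S : List Byte) (x : List Byte) : Prop := ∀ c ∈ x.head?, c ∈ S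

theorem startsIn_nil (S : List Byte) : StartsIn S [] := by simp [StartsIn]

theorem StartsIn.mono {S S' x : List Byte} (h : StartsIn S x) (hS : S ⊆ S') : StartsIn S' x :=
  fun c hc => hS (h c hc)

theorem StartsIn.append {S S' v x : List Byte} (hv : StartsIn S v) (hx : v = [] → StartsIn S' x) :
    StartsIn (S ++ S') (v ++ x) := by
  cases v with
  | nil => exact (hx rfl).mono (by simp)
  | cons a v => exact StartsIn.mono (x := a :: (v ++ x)) (fun c hc => hv c hc) (by simp)

variable {k : ℕ}

/-- Only this direction is needed: `nullable` and `first` may overestimate, since they serve to rule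
out collisions. -/
theorem Parses.nullable {a : Schema} {t : Tree} {v : List Byte} (h : Parses k a t v)
    (hv : v = []) : a.nullable = true := by
  induction h with
  | eps | starNil | starCons => rfl
  | lit w => simp [Schema.nullable, hv]
  | prim | constr => simp at hv
  | any i v hi hl =>
    obtain rfl : i = [] := by simp_all
    simp [identOK] at hi
  | seq a b t u v w ha hb iha ihb =>
    rw [List.append_eq_nil_iff] at hv
    simp [Schema.nullable, iha hv.1, ihb hv.2]
  | altL a b t w h ih => simp [Schema.nullable, ih hv]
  | altR a b t w h ih => simp [Schema.nullable, ih hv]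
  | field f a t w h ih => exact ih hv

theorem Parses.startsIn_first {a : Schema} {t : Tree} {v : List Byte} (h : Parses k a t v) :
    StartsIn a.first v := by
  induction h with
  | eps | starNil => exact startsIn_nil _
  | lit w => intro c hc; simpa [first] using hc
  | prim | constr => intro c hc; simpa [first, eq_comm] using hc
  | any i v hi hl => intro c hc; simp [first]
  | seq a b t u v w ha hb iha ihb =>
    refine iha.append fun hv => ?_
    rwa [if_pos (ha.nullable hv)]
  | altL a b t w h ih => exact ih.mono (by simp [first])
  | altR a b t w h ih => exact ih.mono (by simp [first])
  | starCons a t u v w ha hs iha ihs =>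
    exact (iha.append fun _ => ihs).mono (by simp [first])
  | field f a t w h ih => exact ih

theorem Parses.startsIn_firstWith {a : Schema} {t : Tree} {v x S : List Byte} (h : Parses k a t v)
    (hx : StartsIn S x) : StartsIn (a.firstWith S) (v ++ x) := by
  refine h.startsIn_first.append fun hv => ?_
  rwa [if_pos (h.nullable hv)]

/-! ### Deterministic parsing -/

/-- A match of the schema `a` followed by the empty string or an octet of `S` determines its end
and its parse tree. -/
def Determined (k : ℕ) (a : Schema) (S : List Byte) : Prop :=
  ∀ ⦃t t' : Tree⦄ ⦃v v' x x' : List Byte⦄, Parses k a t v → Parses k a t' v' →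
    StartsIn S x → StartsIn S x' → v ++ x = v' ++ x' → t = t' ∧ v = v'

/-- No string begins both with a match of `a` and with a match of `b`. -/
def Separated (k : ℕ) (a b : Schema) : Prop :=
  ∀ ⦃t t' : Tree⦄ ⦃v v' x x' : List Byte⦄, Parses k a t v → Parses k b t' v' →
    v ++ x ≠ v' ++ x'

/-- An empty set of followers forces the continuation to be empty, so two parses of a complete
string are being compared. -/
theorem Determined.parse_unique {a : Schema} (h : Determined k a []) {t t' : Tree}
    {w : List Byte} (ht : Parses k a t w) (ht' : Parses k a t' w) : t = t' :=
  (h ht ht' (startsIn_nil _) (startsIn_nil _) rfl).1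

theorem determined_fail (S : List Byte) : Determined k .fail S := by
  intro t t' v v' x x' h
  cases h

theorem determined_eps (S : List Byte) : Determined k .eps S := by
  intro t t' v v' x x' h h' _ _ _
  cases h
  cases h'
  exact ⟨rfl, rfl⟩

theorem determined_lit (w S : List Byte) : Determined k (.lit w) S := by
  intro t t' v v' x x' h h' _ _ _
  cases h
  cases h'
  exact ⟨rfl, rfl⟩

theorem Determined.field {a : Schema} {S : List Byte} (f : Field) (h : Determined k a S) :
    Determined k (.field f a) S := by
  intro t t' v v' x x' hv hv' hx hx' e
  cases hv with
  | field _ _ t _ hv =>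
    cases hv' with
    | field _ _ t' _ hv' =>
      obtain ⟨rfl, rfl⟩ := h hv hv' hx hx' e
      exact ⟨rfl, rfl⟩

/-- What follows the match of `a` is a match of `b` and then the continuation, hence begins in
`b.firstWith S`. The first parts therefore agree, and cancelling them leaves the claim for `b`. -/
theorem Determined.seq {a b : Schema} {S : List Byte} (ha : Determined k a (b.firstWith S))
    (hb : Determined k b S) : Determined k (.seq a b) S := by
  intro t t' v v' x x' hv hv' hx hx' e
  cases hv with
  | seq _ _ t u v w h1 h2 =>
    cases hv' with
    | seq _ _ t' u' v' w' h1' h2' =>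
      rw [List.append_assoc, List.append_assoc] at e
      obtain ⟨rfl, rfl⟩ :=
        ha h1 h1' (h2.startsIn_firstWith hx) (h2'.startsIn_firstWith hx') e
      obtain ⟨rfl, rfl⟩ := hb h2 h2' hx hx' (List.append_cancel_left e)
      exact ⟨rfl, rfl⟩

/-- Common core of the two ways to resolve an alternative: by the next octet, where the conditions
on `x` and `x'` matter, and by `Separated`, where they do not. -/
theorem Determined.alt_of_ne {a b : Schema} {S : List Byte} (ha : Determined k a S)
    (hb : Determined k b S)
    (hab : ∀ ⦃t t' : Tree⦄ ⦃v v' x x' : List Byte⦄, Parses k a t v → Parses k b t' v' →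
      StartsIn S x → StartsIn S x' → v ++ x ≠ v' ++ x') : Determined k (.alt a b) S := by
  intro t t' v v' x x' hv hv' hx hx' e
  cases hv with
  | altL _ _ t _ hv =>
    cases hv' with
    | altL _ _ t' _ hv' =>
      obtain ⟨rfl, rfl⟩ := ha hv hv' hx hx' e
      exact ⟨rfl, rfl⟩
    | altR _ _ t' _ hv' => exact absurd e (hab hv hv' hx hx')
  | altR _ _ t _ hv =>
    cases hv' with
    | altL _ _ t' _ hv' => exact absurd e.symm (hab hv' hv hx' hx)
    | altR _ _ t' _ hv' =>
      obtain ⟨rfl, rfl⟩ := hb hv hv' hx hx' e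
      exact ⟨rfl, rfl⟩

/-- An alternative whose branches are told apart by the next octet. -/
theorem Determined.alt {a b : Schema} {S : List Byte} (ha : Determined k a S)
    (hb : Determined k b S)
    (hab : (a.nullable && b.nullable) = false ∧ ∀ c ∈ a.firstWith S, c ∉ b.firstWith S) :
    Determined k (.alt a b) S := by
  refine ha.alt_of_ne hb fun t t' v v' x x' hv hv' hx hx' e => ?_
  have h1 := hv.startsIn_firstWith hx
  have h2 := hv'.startsIn_firstWith hx'
  rw [← e] at h2
  cases hvx : v ++ x with
  | nil =>
    -- If no next octet exists, both branches matched the empty string, which the first half of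
    -- `hab` excludes.
    have h3 : v = [] := (List.append_eq_nil_iff.1 hvx).1
    have h4 : v' = [] := (List.append_eq_nil_iff.1 (e.symm.trans hvx)).1
    have := hab.1
    rw [hv.nullable h3, hv'.nullable h4] at this
    cases this
  | cons c l =>
    rw [hvx] at h1 h2
    exact hab.2 c (h1 c rfl) (h2 c rfl)

/-- Removes `S` from the side condition for non-nullable branches, so that it can be evaluated while
`S` is still a variable. -/
theorem firstWith_eq_first {a : Schema} (h : a.nullable = false) (S : List Byte) :
    a.firstWith S = a.first := by
  simp [firstWith, h]

/-- An alternative of non-empty strings whose branches are told apart by their first octet. -/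
theorem Determined.alt_of_first {a b : Schema} {S : List Byte} (ha : Determined k a S)
    (hb : Determined k b S)
    (hab : a.nullable = false ∧ b.nullable = false ∧ ∀ c ∈ a.first, c ∉ b.first) :
    Determined k (.alt a b) S := by
  refine ha.alt hb ⟨by simp [hab.1], ?_⟩
  rw [firstWith_eq_first hab.1, firstWith_eq_first hab.2.1]
  exact hab.2.2

theorem Separated.choice_right {a : Schema} {l : List Schema} (h : ∀ b ∈ l, Separated k a b) :
    Separated k a (choice l) := by
  intro t t' v v' x x' hv hv'
  induction l generalizing t' with
  | nil => cases hv'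
  | cons b l ih =>
    cases hv' with
    | altL _ _ t' _ hv' => exact h b (by simp) hv hv'
    | altR _ _ t' _ hv' => exact ih (fun b hb => h b (by simp [hb])) hv'

/-- A choice whose branches exclude each other, whatever follows. -/
theorem Determined.choice {l : List Schema} {S : List Byte} (h : ∀ a ∈ l, Determined k a S)
    (hl : l.Pairwise (Separated k)) : Determined k (choice l) S := by
  induction l with
  | nil => exact determined_fail S
  | cons a l ih =>
    obtain ⟨h1, h2⟩ := List.pairwise_cons.1 hl
    exact (h a (by simp)).alt_of_ne (ih (fun b hb => h b (by simp [hb])) h2)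
      fun _ _ _ _ _ _ hv hv' _ _ => Separated.choice_right h1 hv hv'

/-- Each round consumes at least one octet and starts outside `S`, so the next octet tells whether
the repetition goes on. Inside the repetition a round is followed by another round or by the
continuation, which explains `a.first ++ S`. -/
theorem Determined.star {a : Schema} {S : List Byte} (ha : Determined k a (a.first ++ S))
    (h : a.nullable = false ∧ ∀ c ∈ S, c ∉ a.first) : Determined k (.star a) S := by
  have ne : ∀ {t v w x x'}, Parses k a t v → StartsIn S x → x ≠ v ++ w ++ x' := by
    intro t v w x x' hv hx e
    cases v with
    | nil => simpa [h.1] using hv.nullable rfl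
    | cons c v =>
      subst e
      exact h.2 c (hx c rfl) (hv.startsIn_first c rfl)
  intro t t' v v' x x' hv hv' hx hx' e
  generalize hs : Schema.star a = s at hv
  induction hv generalizing t' v' with
  | starNil b =>
    cases hs
    cases hv' with
    | starNil => exact ⟨rfl, rfl⟩
    | starCons _ t u v w h1 h2 => exact absurd e (ne h1 hx)
  | starCons b t u v w h1 h2 ih1 ih2 =>
    cases hs
    cases hv' with
    | starNil => exact absurd e.symm (ne h1 hx')
    | starCons _ t' u' v' w' h1' h2' =>
      rw [List.append_assoc, List.append_assoc] at e
      obtain ⟨rfl, rfl⟩ := ha h1 h1' (h2.startsIn_first.append fun _ => hx)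
        (h2'.startsIn_first.append fun _ => hx') e
      obtain ⟨rfl, rfl⟩ := ih2 h2' (List.append_cancel_left e) rfl
      exact ⟨rfl, rfl⟩
  | _ => cases hs

/-! ### Encoded types as self-delimiting units -/

section TagLengthValue

variable [hk : Fact (k ≤ 126)]

theorem tlv_append_inj {i : Byte} {v v' x x' : List Byte}
    (hv : LengthOK k v.length) (hv' : LengthOK k v'.length)
    (e : [i] ++ lengthOctets v.length ++ v ++ x = [i] ++ lengthOctets v'.length ++ v' ++ x') :
    v = v' ∧ x = x' := by
  simp only [List.append_assoc] at e
  have e := List.append_cancel_left e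
  simp only [← List.append_assoc] at e
  exact lengthOctets_append_inj hk.out hv hv' e

theorem determined_prim (i : Byte) (ok : List Byte → Bool) (S : List Byte) :
    Determined k (.prim i ok) S := by
  intro t t' v v' x x' hv hv' _ _ e
  cases hv with
  | prim _ _ v _ hl =>
    cases hv' with
    | prim _ _ v' _ hl' =>
      obtain ⟨rfl, -⟩ := tlv_append_inj hl hl' e
      exact ⟨rfl, rfl⟩

theorem determined_any (S : List Byte) : Determined k .any S := by
  intro t t' v v' x x' hv hv' _ _ e
  cases hv with
  | any i v hi hl =>
    cases hv' with
    | any i' v' hi' hl' =>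
      simp only [List.append_assoc] at e
      obtain rfl := identOK_inj_of_append hi hi' e
      have e := List.append_cancel_left e
      simp only [← List.append_assoc] at e
      obtain ⟨rfl, -⟩ := lengthOctets_append_inj hk.out hl hl' e
      exact ⟨rfl, rfl⟩

/-- The length octets cut out the contents, so the body needs to be determined only as a complete
string, and `S` is irrelevant. -/
theorem Determined.constr {body : Schema} (i : Byte) (S : List Byte)
    (h : Determined k body []) : Determined k (.constr i body) S := by
  intro t t' v v' x x' hv hv' _ _ e
  cases hv with
  | constr _ _ t v hv hl =>
    cases hv' with
    | constr _ _ t' v' hv' hl' =>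
      obtain ⟨rfl, -⟩ := tlv_append_inj hl hl' e
      obtain rfl := h.parse_unique hv hv'
      exact ⟨rfl, rfl⟩

theorem separated_prim (i : Byte) {ok ok' : List Byte → Bool}
    (h : ∀ c, ok c = true → ok' c = true → False) :
    Separated k (.prim i ok) (.prim i ok') := by
  intro t t' v v' x x' hv hv' e
  cases hv with
  | prim _ _ v ho hl =>
    cases hv' with
    | prim _ _ v' ho' hl' =>
      obtain ⟨rfl, -⟩ := tlv_append_inj hl hl' e
      exact h v ho ho'

theorem Separated.constr {a b : Schema} (i : Byte) (h : Separated k a b) :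
    Separated k (.constr i a) (.constr i b) := by
  intro t t' v v' x x' hv hv' e
  cases hv with
  | constr _ _ t v hv hl =>
    cases hv' with
    | constr _ _ t' v' hv' hl' =>
      obtain ⟨rfl, -⟩ := tlv_append_inj hl hl' e
      -- The contents coincide as complete strings, so separation of the bodies applies with empty
      -- continuations.
      exact h (x := []) (x' := []) hv hv' rfl

end TagLengthValue

theorem Separated.field {a b : Schema} (f g : Field) (h : Separated k a b) :
    Separated k (.field f a) (.field g b) := by
  intro t t' v v' x x' hv hv' e
  cases hv with
  | field _ _ t _ hv =>
    cases hv' with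
    | field _ _ t' _ hv' => exact h hv hv' e

theorem Separated.seq {a b : Schema} (c d : Schema) (h : Separated k a b) :
    Separated k (.seq a c) (.seq b d) := by
  intro t t' v v' x x' hv hv' e
  cases hv with
  | seq _ _ t u v w h1 h2 =>
    cases hv' with
    | seq _ _ t' u' v' w' h1' h2' =>
      rw [List.append_assoc, List.append_assoc] at e
      exact h h1 h1' e

theorem Determined.mono {a : Schema} {S S' : List Byte} (h : Determined k a S') (hS : S ⊆ S') :
    Determined k a S :=
  fun _ _ _ _ _ _ hv hv' hx hx' => h hv hv' (hx.mono hS) (hx'.mono hS)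

theorem first_upTo_subset {a : Schema} (n : ℕ) (h : a.nullable = false) :
    (Schema.upTo n a).first ⊆ a.first := by
  cases n <;> simp [Schema.upTo, opt, first, h]

theorem Determined.upTo {a : Schema} {S : List Byte} (n : ℕ)
    (ha : Determined k a (a.first ++ S)) (h : a.nullable = false ∧ ∀ c ∈ S, c ∉ a.first) :
    Determined k (upTo n a) S := by
  induction n with
  | zero => exact determined_eps S
  | succ n ih =>
    refine Determined.alt (Determined.seq (ha.mono ?_) ih) (determined_eps S) ⟨?_, ?_⟩
    -- A copy of `a` is followed by a further copy or by the continuation, so its followers lie in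
    -- `a.first ++ S`.
    · refine List.append_subset.2 ⟨fun c hc => ?_, ?_⟩
      · exact List.mem_append_left _ (first_upTo_subset n h.1 hc)
      · split_ifs <;> simp
    · simp [nullable, h.1]
    · intro c hc hc'
      refine h.2 c (by simpa [firstWith, first, nullable] using hc') ?_
      simpa [firstWith, first, nullable, h.1] using hc

/-! ### Choices governed by an object identifier -/

section ObjectIdentifiers

variable [Fact (k ≤ 126)]

theorem separated_thisOid {o o' : List ℕ} (h : oidOctets o ≠ oidOctets o') :
    Separated k (thisOid o) (thisOid o') := by
  refine separated_prim _ fun c h1 h2 => h ?_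
  rw [← beq_iff_eq.1 h1, ← beq_iff_eq.1 h2]

theorem separated_otherOid {o : List ℕ} {l : List (List ℕ)} (h : o ∈ l) :
    Separated k (thisOid o) (otherOid l) := by
  refine separated_prim _ fun c h1 h2 => ?_
  have h3 := List.all_eq_true.1 (Bool.and_eq_true_iff.1 h2).2 o h
  exact bne_iff_ne.1 h3 (beq_iff_eq.1 h1)

theorem Separated.sequence {a b : Schema} (l m : List Schema) (h : Separated k a b) :
    Separated k (sequence (a :: l)) (sequence (b :: m)) :=
  (h.seq _ _).constr _

/-- Reduces exclusiveness of the branches to distinctness of the encoded object identifiers, a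
closed statement for each table; `hg` carries the separation from the identifier out to the whole
branch. -/
theorem pairwise_separated_map {α : Type*} {l : List α} {o : α → List ℕ} {g : α → Schema}
    (hl : ((l.map o).map oidOctets).Nodup)
    (hg : ∀ a b, Separated k (thisOid (o a)) (thisOid (o b)) → Separated k (g a) (g b)) :
    (l.map g).Pairwise (Separated k) := by
  rw [List.map_map] at hl
  refine List.pairwise_map.2 ((List.pairwise_map.1 hl).imp fun {a b} h => ?_)
  exact hg a b (separated_thisOid h)

theorem pairwise_separated_map_append {α : Type*} {l : List α} {o : α → List ℕ} {g : α → Schema}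
    {z : Schema} (hl : ((l.map o).map oidOctets).Nodup)
    (hg : ∀ a b, Separated k (thisOid (o a)) (thisOid (o b)) → Separated k (g a) (g b))
    (hz : ∀ a, Separated k (thisOid (o a)) (otherOid (l.map o)) → Separated k (g a) z) :
    (l.map g ++ [z]).Pairwise (Separated k) := by
  refine List.pairwise_append.2 ⟨pairwise_separated_map hl hg, List.pairwise_singleton _ _, ?_⟩
  intro b hb z' hz'
  obtain ⟨a, ha, rfl⟩ := List.mem_map.1 hb
  rw [List.mem_singleton.1 hz']
  exact hz a (separated_otherOid (List.mem_map_of_mem ha))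

end ObjectIdentifiers

/-! ### The certificate schema -/

section Certificates

variable [Fact (k ≤ 126)] (S : List Byte)

/-! ### Algorithm parameters -/

theorem determined_hashIdentifier : Determined k hashIdentifier S := by
  -- All branches begin with the octet 0x30, so only the object identifier inside can separate them.
  refine Determined.choice (List.forall_mem_map.2 fun n _ => ?_)
    (pairwise_separated_map (o := fun n => [2, 16, 840, 1, 101, 3, 4, 2, n])
      (by decide +kernel) fun a b h => h.sequence _ _)
  refine Determined.constr _ _ (Determined.seq (determined_prim _ _ _) (Determined.seq ?_
    (determined_eps _)))
  exact Determined.alt (determined_prim _ _ _) (determined_eps _) (by decide +kernel)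

theorem determined_mgf1Identifier : Determined k mgf1Identifier S := by
  repeat'
    first
      | exact determined_hashIdentifier _ | exact determined_prim _ _ _ | exact determined_eps _
      | refine Determined.seq ?_ ?_ | refine Determined.constr _ _ ?_

/-- Structural recursion along the schema: each constructor has its rule, settled subschemas are
closed before they are unfolded, and an optional component has a tag different from everything that
can follow it. -/
theorem determined_pssParams : Determined k pssParams S := by
  repeat'
    first
      | exact determined_hashIdentifier _ | exact determined_mgf1Identifier _
      | exact determined_prim _ _ _ | exact determined_eps _ | refine Determined.seq ?_ ?_
      | refine Determined.constr _ _ ?_ | refine Determined.alt ?_ ?_ (by decide +kernel)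

theorem determined_oaepParams : Determined k oaepParams S := by
  repeat'
    first
      | exact determined_hashIdentifier _ | exact determined_mgf1Identifier _
      | exact determined_prim _ _ _ | exact determined_eps _ | refine Determined.seq ?_ ?_
      | refine Determined.constr _ _ ?_ | refine Determined.alt ?_ ?_ (by decide +kernel)

theorem determined_dssSigValue : Determined k dssSigValue S := by
  repeat'
    first
      | exact determined_prim _ _ _ | exact determined_eps _ | refine Determined.seq ?_ ?_
      | refine Determined.constr _ _ ?_

theorem determined_dhParams : Determined k dhParams S := by
  repeat'
    first
      | exact determined_prim _ _ _ | exact determined_eps _ | refine Determined.seq ?_ ?_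
      | refine Determined.constr _ _ ?_ | refine Determined.alt ?_ ?_ (by decide +kernel)

/-- The empty branch makes the set of followers matter. It is fixed to `[]` because the parameters
end their SEQUENCE, and the side condition becomes closed. -/
theorem determined_gostParams : Determined k gostParams [] := by
  repeat'
    first
      | exact determined_prim _ _ _ | exact determined_eps _ | exact determined_fail _
      | refine Determined.seq ?_ ?_ | refine Determined.constr _ _ ?_
      | refine Determined.alt ?_ ?_ (by decide +kernel)

/-! ### Names -/

theorem determined_directoryString (hi : Option ℕ) : Determined k (directoryString hi) S := by
  repeat'
    first
      | exact determined_prim _ _ _ | exact determined_fail _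
      -- The bound `hi` is a variable, so the condition is simplified rather than decided; the tags
      -- do not depend on it.
      | refine Determined.alt_of_first ?_ ?_ (by simp [Schema.nullable, first])

theorem determined_namingAttribute {p : List ℕ × Schema} (hp : p ∈ namingAttributes) :
    Determined k p.2 S := by
  revert p
  simp only [namingAttributes, List.forall_mem_cons]
  simp only [List.not_mem_nil, false_imp_iff, implies_true, and_true]
  repeat' first | exact determined_directoryString _ _ | exact determined_prim _ _ _ | constructor

theorem determined_attributeTypeAndValue : Determined k attributeTypeAndValue S := by
  refine Determined.choice ?_ (pairwise_separated_map_append (o := Prod.fst) (by decide +kernel)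
    (fun a b h => h.sequence _ _) fun a h => h.sequence _ _)
  refine List.forall_mem_append.2 ⟨List.forall_mem_map.2 fun p hp => ?_, ?_⟩
  · exact .constr _ _ (.seq (determined_prim _ _ _) (.seq (determined_namingAttribute _ hp)
      (determined_eps _)))
  · simp only [List.mem_singleton, forall_eq]
    exact .constr _ _ (.seq (determined_prim _ _ _) (.seq (determined_any _) (determined_eps _)))

theorem determined_relativeDN : Determined k relativeDN S := by
  repeat'
    first
      | exact determined_attributeTypeAndValue _ | refine Determined.constr _ _ ?_
      | refine Determined.seq ?_ ?_ | refine Determined.star ?_ (by decide +kernel)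

theorem determined_name : Determined k name S := by
  repeat'
    first
      | exact determined_relativeDN _ | refine Determined.constr _ _ ?_
      | refine Determined.star ?_ (by decide +kernel)

theorem determined_nonemptyName : Determined k nonemptyName S := by
  repeat'
    first
      | exact determined_relativeDN _ | refine Determined.constr _ _ ?_
      | refine Determined.seq ?_ ?_ | refine Determined.star ?_ (by decide +kernel)

/-! ### General names -/

theorem determined_orAddressBody : Determined k orAddressBody [] := by
  repeat'
    first
      | exact determined_prim _ _ _ | exact determined_eps _ | exact determined_any _
      | refine Determined.upTo _ ?_ (by decide +kernel) | exact determined_fail _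
      | refine Determined.seq ?_ ?_ | refine Determined.constr _ _ ?_
      | refine Determined.alt ?_ ?_ (by decide +kernel)

theorem determined_generalName : Determined k generalName S := by
  repeat'
    first
      | exact determined_orAddressBody | exact determined_name _
      | exact determined_directoryString _ _ | exact determined_prim _ _ _ | exact determined_eps _
      | exact determined_any _ | exact determined_fail _ | refine Determined.seq ?_ ?_
      -- The outer choice has non-empty branches and a variable `S`. Options inside an encoded type
      -- have a nullable branch but a concrete set of followers, and are left to `Determined.alt`.
      | refine Determined.constr _ _ ?_ | refine Determined.alt_of_first ?_ ?_ (by decide +kernel)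
      | refine Determined.alt ?_ ?_ (by decide +kernel)

theorem determined_generalNames : Determined k generalNames S := by
  repeat'
    first
      | exact determined_generalName _ | refine Determined.constr _ _ ?_
      | refine Determined.seq ?_ ?_ | refine Determined.star ?_ (by decide +kernel)

/-! ### Extensions -/

theorem determined_authorityKeyIdentifier : Determined k authorityKeyIdentifier S := by
  repeat'
    first
      | exact determined_generalName _ | exact determined_prim _ _ _ | exact determined_eps _
      | refine Determined.field _ ?_ | refine Determined.seq ?_ ?_
      | refine Determined.constr _ _ ?_ | refine Determined.alt ?_ ?_ (by decide +kernel)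
      | refine Determined.star ?_ (by decide +kernel)

theorem determined_displayText : Determined k displayText S := by
  repeat'
    first
      | exact determined_prim _ _ _ | exact determined_fail _
      | refine Determined.alt_of_first ?_ ?_ (by decide +kernel)

theorem determined_policyQualifierInfo : Determined k policyQualifierInfo S := by
  refine Determined.choice (List.forall_mem_cons.2 ⟨?_, List.forall_mem_singleton.2 ?_⟩)
    (List.pairwise_pair.2 (Separated.sequence _ _ (separated_thisOid (by decide +kernel))))
  all_goals
    repeat'
      first
        | exact determined_displayText _ | exact determined_prim _ _ _ | exact determined_eps _
        | refine Determined.seq ?_ ?_ | refine Determined.constr _ _ ?_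
        | refine Determined.alt ?_ ?_ (by decide +kernel)
        | refine Determined.star ?_ (by decide +kernel)

theorem determined_certificatePolicies : Determined k certificatePolicies S := by
  repeat'
    first
      | exact determined_policyQualifierInfo _ | exact determined_prim _ _ _
      | exact determined_eps _ | refine Determined.seq ?_ ?_ | refine Determined.constr _ _ ?_
      | refine Determined.alt ?_ ?_ (by decide +kernel)
      | refine Determined.star ?_ (by decide +kernel)

theorem determined_policyMappings : Determined k policyMappings S := by
  repeat'
    first
      | exact determined_prim _ _ _ | exact determined_eps _ | refine Determined.seq ?_ ?_
      | refine Determined.constr _ _ ?_ | refine Determined.star ?_ (by decide +kernel)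

theorem determined_subjectDirectoryAttributes : Determined k subjectDirectoryAttributes S := by
  repeat'
    first
      | exact determined_prim _ _ _ | exact determined_eps _ | exact determined_any _
      | refine Determined.seq ?_ ?_ | refine Determined.constr _ _ ?_
      | refine Determined.star ?_ (by decide +kernel)

theorem determined_basicConstraints : Determined k basicConstraints S := by
  repeat'
    first
      | exact determined_prim _ _ _ | exact determined_eps _ | refine Determined.seq ?_ ?_
      | refine Determined.constr _ _ ?_ | refine Determined.alt ?_ ?_ (by decide +kernel)

theorem determined_nameConstraints : Determined k nameConstraints S := by
  repeat'
    first
      | exact determined_generalName _ | exact determined_prim _ _ _ | exact determined_eps _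
      | refine Determined.seq ?_ ?_ | refine Determined.constr _ _ ?_
      | refine Determined.alt ?_ ?_ (by decide +kernel)
      | refine Determined.star ?_ (by decide +kernel)

theorem determined_policyConstraints : Determined k policyConstraints S := by
  repeat'
    first
      | exact determined_prim _ _ _ | exact determined_eps _ | refine Determined.seq ?_ ?_
      | refine Determined.constr _ _ ?_ | refine Determined.alt ?_ ?_ (by decide +kernel)

theorem determined_crlDistributionPoints : Determined k crlDistributionPoints S := by
  repeat'
    first
      | exact determined_generalName _ | exact determined_attributeTypeAndValue _
      | exact determined_prim _ _ _ | exact determined_eps _ | exact determined_fail _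
      | refine Determined.seq ?_ ?_ | refine Determined.constr _ _ ?_
      | refine Determined.alt ?_ ?_ (by decide +kernel)
      | refine Determined.star ?_ (by decide +kernel)

theorem determined_infoAccess : Determined k infoAccess S := by
  repeat'
    first
      | exact determined_generalName _ | exact determined_prim _ _ _ | exact determined_eps _
      | refine Determined.seq ?_ ?_ | refine Determined.constr _ _ ?_
      | refine Determined.star ?_ (by decide +kernel)

theorem determined_standardExtension {p : List ℕ × Schema} (hp : p ∈ standardExtensions) :
    Determined k p.2 [] := by
  revert p
  simp only [standardExtensions, List.forall_mem_cons]
  simp only [List.not_mem_nil, false_imp_iff, implies_true, and_true]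
  refine ⟨determined_authorityKeyIdentifier _, determined_prim _ _ _, determined_prim _ _ _,
    determined_certificatePolicies _, determined_policyMappings _, determined_generalNames _,
    determined_generalNames _, determined_subjectDirectoryAttributes _,
    determined_basicConstraints _, determined_nameConstraints _, determined_policyConstraints _,
    .constr _ _ (.seq (determined_prim _ _ _) (.star (determined_prim _ _ _) (by decide +kernel))),
    determined_crlDistributionPoints _, determined_prim _ _ _, determined_crlDistributionPoints _,
    determined_infoAccess _, determined_infoAccess _⟩

theorem Separated.extensionWith {a b : Schema} (v w : Schema) (h : Separated k a b) :
    Separated k (extensionWith a v) (extensionWith b w) :=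
  (h.field _ _).sequence _ _

theorem determined_extension : Determined k extension S := by
  refine Determined.choice ?_ (pairwise_separated_map_append (o := Prod.fst) (by decide +kernel)
    (fun a b h => h.extensionWith _ _) fun a h => h.extensionWith _ _)
  refine List.forall_mem_append.2 ⟨List.forall_mem_map.2 fun p hp => ?_, ?_⟩
  · have := determined_standardExtension (k := k) hp
    refine .constr _ _ (.seq (.field _ (determined_prim _ _ _)) (.seq ?_ (.seq
      (.field _ (.constr _ _ this)) (determined_eps _))))
    -- The syntax `p.2` is arbitrary here, but the value starts with the OCTET STRING identifier in
    -- any case, which differs from that of BOOLEAN.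
    exact .alt (.field _ (determined_prim _ _ _)) (determined_eps _)
      (by simp [octetStringContaining, boolTrue, Schema.nullable, first, firstWith])
  · simp only [List.mem_singleton, forall_eq]
    refine .constr _ _ (.seq (.field _ (determined_prim _ _ _)) (.seq ?_ (.seq
      (.field _ (determined_prim _ _ _)) (determined_eps _))))
    exact .alt (.field _ (determined_prim _ _ _)) (determined_eps _) (by decide +kernel)

/-! ### Certificates -/

theorem determined_time : Determined k time S := by
  repeat'
    first
      | exact determined_prim _ _ _ | exact determined_fail _
      | refine Determined.alt_of_first ?_ ?_ (by decide +kernel)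

/-- Parameters end the contents of their SEQUENCE, hence `[]`; the value that goes with them stands
in an arbitrary context. -/
theorem determined_signatureAlgorithm {a : Algorithm} (ha : a ∈ signatureAlgorithms) :
    Determined k a.params [] ∧ Determined k a.value S := by
  revert a
  simp only [signatureAlgorithms, List.forall_mem_append, List.forall_mem_map,
    List.forall_mem_singleton]
  refine ⟨⟨⟨⟨fun _ _ => ⟨?_, ?_⟩, ⟨?_, ?_⟩⟩, fun _ _ => ⟨?_, ?_⟩⟩, fun _ _ => ⟨?_, ?_⟩⟩,
    fun _ _ => ⟨?_, ?_⟩⟩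
  all_goals
    repeat'
      first
        | exact determined_pssParams _ | exact determined_dssSigValue _
        | exact determined_prim _ _ _ | exact determined_eps _ | exact determined_lit _ _
        | refine Determined.seq ?_ ?_ | refine Determined.constr _ _ ?_

theorem determined_publicKeyAlgorithm {a : Algorithm} (ha : a ∈ publicKeyAlgorithms) :
    Determined k a.params [] ∧ Determined k a.value S := by
  revert a
  simp only [publicKeyAlgorithms, List.forall_mem_cons]
  simp only [List.not_mem_nil, false_imp_iff, implies_true, and_true]
  refine ⟨⟨?_, ?_⟩, ⟨?_, ?_⟩, ⟨?_, ?_⟩, ⟨?_, ?_⟩, ⟨?_, ?_⟩, ⟨?_, ?_⟩, ⟨?_, ?_⟩, ⟨?_, ?_⟩, ⟨?_, ?_⟩,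
    ⟨?_, ?_⟩, ⟨?_, ?_⟩⟩
  all_goals
    repeat'
      first
        | exact determined_pssParams _ | exact determined_oaepParams _
        | exact determined_dhParams _ | exact determined_gostParams
        | exact determined_prim _ _ _ | exact determined_eps _ | exact determined_lit _ _
        | refine Determined.seq ?_ ?_ | refine Determined.constr _ _ ?_
        | refine Determined.alt ?_ ?_ (by decide +kernel)

theorem Determined.identifier {a : Algorithm} (h : Determined k a.params []) :
    Determined k a.identifier S :=
  .constr _ _ (.seq (determined_prim _ _ _) (.seq h (determined_eps _)))

theorem determined_signatureIdentifier :
    Determined k (choice (signatureAlgorithms.map Algorithm.identifier)) S :=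
  .choice (List.forall_mem_map.2 fun _ ha => .identifier _ (determined_signatureAlgorithm [] ha).1)
    (pairwise_separated_map (o := Algorithm.oid) (by decide +kernel) fun _ _ h => h.sequence _ _)

theorem determined_subjectPublicKeyInfo : Determined k subjectPublicKeyInfo S := by
  refine .choice (List.forall_mem_map.2 fun a ha => ?_)
    (pairwise_separated_map (o := Algorithm.oid) (by decide +kernel)
      -- The deciding object identifier sits at the head of two nested SEQUENCEs.
      fun _ _ h => (h.sequence _ _).sequence _ _)
  exact .constr _ _ (.seq (.identifier _ (determined_publicKeyAlgorithm [] ha).1)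
    (.seq (determined_publicKeyAlgorithm _ ha).2 (determined_eps _)))

theorem determined_tbsCertificate : Determined k tbsCertificate S := by
  repeat'
    first
      | exact determined_signatureIdentifier _ | exact determined_nonemptyName _
      | exact determined_name _ | exact determined_time _
      | exact determined_subjectPublicKeyInfo _ | exact determined_extension _
      | exact determined_prim _ _ _ | exact determined_eps _ | refine Determined.field _ ?_
      | refine Determined.seq ?_ ?_ | refine Determined.constr _ _ ?_
      | refine Determined.alt ?_ ?_ (by decide +kernel)
      | refine Determined.star ?_ (by decide +kernel)

theorem determined_certificate : Determined k certificate S := by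
  refine .constr _ _ (.seq (.field _ (determined_tbsCertificate _)) (.seq ?_ (determined_eps _)))
  refine .choice (List.forall_mem_map.2 fun a ha => ?_)
    (pairwise_separated_map (o := Algorithm.oid) (by decide +kernel)
      fun _ _ h => ((h.sequence _ _).field _ _).seq _ _)
  exact .seq (.field _ (.identifier _ (determined_signatureAlgorithm [] ha).1))
    (.field _ (determined_signatureAlgorithm _ ha).2)

end Certificates

/-! ### Length bound and conclusion -/

/-- A certificate is a single encoded type, and thus of bounded length. -/
theorem exists_length_le_of_parses_certificate (hk : k ≤ 126) :
    ∃ N, ∀ t w, Parses k certificate t w → w.length ≤ N := by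
  -- One identifier octet, at most 1 + 126 length octets, and contents shorter than 128 or than `256
  -- ^ k`, bounded by the sum.
  refine ⟨1 + (127 + (128 + 256 ^ k)), fun t w h => ?_⟩
  cases h with
  | constr _ _ t v _ hl =>
    have h1 : v.length ≤ 128 + 256 ^ k := by
      rcases hl with hl | hl
      · exact hl.le.trans (Nat.le_add_right _ _)
      · exact hl.le.trans (Nat.le_add_left _ _)
    have h2 : (lengthOctets v.length).length ≤ 127 := by
      unfold lengthOctets
      split_ifs with h
      · simp
      · have := length_digitsBE_le (hl.resolve_left h)
        simp only [List.length_cons, List.length_map]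
        omega
    simp only [List.length_append, List.length_singleton]
    omega

end X509

theorem lemma2 (k : ℕ) (hk : k ≤ 126) (R : Language X509.Byte) :
    -- the language is not inherently ambiguous
    ¬ X509.InherentlyAmbiguous (X509.LX509r2 k R) ∧
    -- every sentence has exactly one parse, and that parse passes all checks
    (∀ w ∈ X509.LX509r2 k R, ∃ t, X509.Parses k X509.certificate t w ∧
      X509.DistinctExtensions t ∧ X509.VersionOK t ∧
      X509.AlgorithmsMatch t ∧ X509.SelfIssuedOK t ∧
      ∀ t', X509.Parses k X509.certificate t' w → t' = t) ∧
    -- the first stage is a deterministic finite-state recognizer, with one path per accepted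
    -- string, and its sentences already have exactly one parse
    (∃ (σ : Type) (_ : Fintype σ) (M : DFA X509.Byte σ), M.accepts = X509.LReg k R ∧
      ∀ w ∈ X509.LReg k R, ∃! p : List σ, X509.AcceptingPath M.toNFA w p) ∧
    (∀ w ∈ X509.LReg k R, ∃! t, X509.Parses k X509.certificate t w) ∧
    -- the later stages keep or discard a string by two checks on its parse
    (∀ w, w ∈ X509.LX509r2 k R ↔ w ∈ X509.LReg k R ∧
      ∀ t, X509.Parses k X509.certificate t w → X509.AlgorithmsMatch t ∧ X509.SelfIssuedOK t) := by
  have : Fact (k ≤ 126) := ⟨hk⟩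
  have uniq : ∀ {t t' w}, X509.Parses k X509.certificate t w →
      X509.Parses k X509.certificate t' w → t' = t :=
    fun h h' => (X509.determined_certificate []).parse_unique h' h
  obtain ⟨N, hN⟩ := X509.exists_length_le_of_parses_certificate hk
  have hlen : ∀ w ∈ X509.LReg k R, w.length ≤ N := by
    rintro w ⟨⟨⟨t, ht, -⟩, -⟩, -⟩
    exact hN t w ht
  refine ⟨?_, ?_, ?_, ?_, fun w => ⟨?_, ?_⟩⟩
  · exact X509.not_inherentlyAmbiguous_of_finite
      ((List.finite_length_le X509.Byte N).subset fun w hw => hlen w hw.2)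
  · rintro w ⟨⟨⟨t, ht, h1⟩, t2, ht2, h2⟩, ⟨⟨t3, ht3, h3⟩, t4, ht4, h4⟩, -⟩
    -- Each condition came with its own parse; uniqueness identifies the four trees.
    obtain rfl := uniq ht ht2
    obtain rfl := uniq ht ht3
    obtain rfl := uniq ht ht4
    exact ⟨_, ht, h3, h4, h1, h2, fun t' ht' => uniq ht ht'⟩
  -- Only the length bound enters, so `R` may be any language.
  · obtain ⟨σ, hσ, M, hM⟩ := X509.isRegular_of_length_le N hlen
    exact ⟨σ, hσ, M, hM, fun w hw => X509.existsUnique_acceptingPath (hM ▸ hw)⟩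
  · rintro w ⟨⟨⟨t, ht, -⟩, -⟩, -⟩
    exact ⟨t, ht, fun t' ht' => uniq ht ht'⟩
  · rintro ⟨⟨⟨t, ht, h1⟩, t2, ht2, h2⟩, h3⟩
    obtain rfl := uniq ht ht2
    refine ⟨h3, fun t' ht' => ?_⟩
    obtain rfl := uniq ht ht'
    exact ⟨h1, h2⟩
  · rintro ⟨hw, h⟩
    obtain ⟨⟨⟨t, ht, -⟩, -⟩, -⟩ := id hw
    exact ⟨⟨⟨t, ht, (h t ht).1⟩, t, ht, (h t ht).2⟩, hw⟩
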